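/- Let $0<\alpha\le \pi/2$, let $\Delta=\{re^{i\theta} : r\ge 0,\ |\theta|\le\alpha\}\subset\mathbb C$ carry two-dimensional Lebesgue measure $m$, and let $\mathbb K\in\{\mathbb R,\mathbb C\}$, $1\le p<\infty$. Let $\rho:\Delta\to[0,\infty)$ be an admissible weight, i.e. $\rho$ is measurable and there are constants $M\ge 1$, $w\in\mathbb R$ with $$\rho(t)\le M e^{w|t'|}\rho(t+t')\qquad\text{for all } t,t'\in\Delta .$$ Let $X=L^p_\rho(\Delta,\mathbb K)$ be the space of (classes of) measurable $u:\Delta\to\mathbb K$ with $\|u\|=\left(\int_\Delta|u|^p\rho\,dm\right)^{1/p}<\infty$, functions being identified when they agree $\rho\,dm$-almost everywhere, and let $(T_tf)(x)=f(x+t)$, $x,t\in\Delta$, be the translation semigroup on $X$. If $\int_\Delta\rho\,dm<\infty$, then the following hold. 1. $\{T_t\}_{t\in\Delta}$ satisfies the Frequent Hypercyclicity Criterion: $\{T_t\}_{t\in\Delta}$ is a $C_0$-semigroup of bounded linear operators on the separable Banach space $X$ (that is, $T_0=I$, $T_{s+t}=T_sT_t$, and $t\mapsto T_tx$ is continuous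 on $\Delta$ for every $x\in X$), and there are a dense subset $X_0\subset X$ and maps $S_t:X_0\to X$, $t\in\Delta$, such that for every $x\in X_0$: (i) for every $\varepsilon>0$ there is $r_\varepsilon>0$ such that $$\sup\Big\|\sum_{n\in J}T_{\lambda_n}S_{\mu_n}x\Big\|<\varepsilon ,$$ the supremum being over all finite $J\subset\mathbb N$ and all $\lambda_n,\mu_n\in\Delta$ such that the numbers $\gamma_n:=|\lambda_n-\mu_n|$ satisfy $|\gamma_n|\ge r_\varepsilon$ for $n\in J$ and $|\gamma_n-\gamma_k|\ge 1$ for all $n\ne k$ in $J$; (ii) $T_tS_tx\to x$ as $|t|\to\infty$, $t\in\Delta$. 2. The criterion of part 1 also holds in the stronger form in which the condition in (i) is imposed on the complex numbers $\gamma_n:=\lambda_n-\mu_n$ instead of $\gamma_n:=|\lambda_n-\mu_n|$. 3. $\{T_t\}_{t\in\Delta}$ is frequently hypercyclic: there is $x\in X$ such that for every non-empty open $U\subset X$, $$\liminf_{r\to\infty}\frac{m(\{t\in\Delta : T_tx\in U,\ |t|\le r\})}{m(\{t\in\Delta : |t|\le r\})}>0 .$$ -/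

import Mathlib

open MeasureTheory Filter Topology
open scoped ENNReal NNReal

noncomputable section

namespace ComplexSector

/-- The point set `Δ(α) = {r e^{iθ} : r ≥ 0, |θ| ≤ α}`. -/
def sectorSet (α : ℝ) : Set ℂ :=
  {z | ∃ r θ : ℝ, 0 ≤ r ∧ |θ| ≤ α ∧ z = r * Complex.exp (θ * Complex.I)}

/-- Description of the sector by linear inequalities. -/
theorem mem_sectorSet_iff {α : ℝ} (hα : 0 < α ∧ α ≤ Real.pi / 2) (z : ℂ) :
    z ∈ sectorSet α ↔ 0 ≤ z.re ∧ |z.im| * Real.cos α ≤ z.re * Real.sin α := by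
  have hpi := Real.pi_pos
  constructor
  · rintro ⟨r, θ, hr, hθ, rfl⟩
    have hre : ((r : ℂ) * Complex.exp (θ * Complex.I)).re = r * Real.cos θ := by
      simp [Complex.exp_ofReal_mul_I_re]
    have him : ((r : ℂ) * Complex.exp (θ * Complex.I)).im = r * Real.sin θ := by
      simp [Complex.exp_ofReal_mul_I_im]
    rw [hre, him]
    have hc : 0 ≤ Real.cos |θ| := Real.cos_nonneg_of_neg_pi_div_two_le_of_le
      (by linarith [abs_nonneg θ]) (by linarith)
    have hs : 0 ≤ Real.sin (α - |θ|) := Real.sin_nonneg_of_nonneg_of_le_pi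
      (by linarith) (by linarith [abs_nonneg θ])
    have habs : |Real.sin θ| = Real.sin |θ| :=
      (Real.abs_sin_eq_sin_abs_of_abs_le_pi (by linarith))
    rw [Real.sin_sub] at hs
    rw [abs_mul, abs_of_nonneg hr, habs, ← Real.cos_abs θ]
    exact ⟨mul_nonneg hr hc, by nlinarith⟩
  · rintro ⟨h0, h1⟩
    refine ⟨‖z‖, Complex.arg z, norm_nonneg z, ?_, (Complex.norm_mul_exp_arg_mul_I z).symm⟩
    by_contra hlt
    push Not at hlt
    have hz : z ≠ 0 := by
      rintro rfl
      simp at hlt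
      linarith
    have hn : 0 < ‖z‖ := norm_pos_iff.mpr hz
    have hle : |Complex.arg z| ≤ Real.pi / 2 := Complex.abs_arg_le_pi_div_two_iff.mpr h0
    have hs : 0 < Real.sin (|Complex.arg z| - α) :=
      Real.sin_pos_of_pos_of_lt_pi (by linarith) (by linarith)
    have habs : |Real.sin (Complex.arg z)| = Real.sin |Complex.arg z| :=
      (Real.abs_sin_eq_sin_abs_of_abs_le_pi (by linarith))
    have hre : z.re = ‖z‖ * Real.cos |Complex.arg z| := by
      rw [Real.cos_abs, Complex.norm_mul_cos_arg]
    have him : |z.im| = ‖z‖ * Real.sin |Complex.arg z| := by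
      conv_lhs => rw [← Complex.norm_mul_sin_arg z, abs_mul, abs_of_pos hn, habs]
    rw [Real.sin_sub] at hs
    rw [hre, him] at h1
    nlinarith

/-- The sector `Δ = Δ(α)`, `0 < α ≤ π/2`, as an additive submonoid of `ℂ`. -/
def sector (α : ℝ) (hα : 0 < α ∧ α ≤ Real.pi / 2) : AddSubmonoid ℂ where
  carrier := sectorSet α
  zero_mem' := ⟨0, 0, le_rfl, by simpa using hα.1.le, by simp⟩
  add_mem' := by
    intro a b ha hb
    rw [mem_sectorSet_iff hα] at *
    have hc : 0 ≤ Real.cos α := Real.cos_nonneg_of_neg_pi_div_two_le_of_le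
      (by linarith [Real.pi_pos, hα.1]) hα.2
    refine ⟨by simpa using add_nonneg ha.1 hb.1, ?_⟩
    have := mul_le_mul_of_nonneg_right (abs_add_le a.im b.im) hc
    simp only [Complex.add_im, Complex.add_re]
    linarith [ha.2, hb.2]

theorem measurableSet_sector {α : ℝ} (hα : 0 < α ∧ α ≤ Real.pi / 2) :
    MeasurableSet (sector α hα : Set ℂ) := by
  have : (sector α hα : Set ℂ) =
      {z : ℂ | 0 ≤ z.re} ∩ {z : ℂ | |z.im| * Real.cos α ≤ z.re * Real.sin α} := by
    ext z
    exact mem_sectorSet_iff hα z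
  rw [this]
  refine IsClosed.measurableSet (IsClosed.inter ?_ ?_)
  · exact isClosed_le continuous_const Complex.continuous_re
  · exact isClosed_le (by fun_prop) (by fun_prop)

variable {α : ℝ} {hα : 0 < α ∧ α ≤ Real.pi / 2}

/-- Lebesgue measure on the sector (two-dimensional, inherited from `ℂ`). -/
def lebesgue : Measure (sector α hα) := (volume : Measure ℂ).comap Subtype.val

/-- The Lebesgue measure of a set of points of the sector is its area in `ℂ`. -/
theorem lebesgue_apply (B : Set (sector α hα)) :
    lebesgue B = volume (Subtype.val '' B : Set ℂ) :=
  (MeasurableEmbedding.subtype_coe (measurableSet_sector hα)).comap_apply volume B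

/-! ### Semigroups indexed by a sector -/

section Semigroups

variable {𝕂 : Type*} [RCLike 𝕂] {X : Type*} [NormedAddCommGroup X] [NormedSpace 𝕂 X]

/-- A strongly continuous semigroup of bounded operators indexed by the sector. -/
structure IsC0Semigroup (T : sector α hα → X →L[𝕂] X) : Prop where
  map_zero : T 0 = ContinuousLinearMap.id 𝕂 X
  map_add : ∀ s t, T (s + t) = (T s).comp (T t)
  continuous_orbit : ∀ x, Continuous fun t => T t x

/-- Lower density `liminf_{r → ∞} m(A ∩ Δ_r) / m(Δ_r)`, where `Δ_r = {s ∈ Δ : |s| ≤ r}` and `m`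
is Lebesgue measure on the sector. -/
def lowerDensity (A : Set (sector α hα)) : ℝ≥0∞ :=
  liminf (fun r : ℝ => lebesgue (A ∩ {s : sector α hα | ‖(s : ℂ)‖ ≤ r}) /
    lebesgue {s : sector α hα | ‖(s : ℂ)‖ ≤ r}) atTop

/-- Some orbit visits every non-empty open set in a set of times of positive lower density. -/
def IsFrequentlyHypercyclic (T : sector α hα → X →L[𝕂] X) : Prop :=
  ∃ x : X, ∀ U : Set X, IsOpen U → U.Nonempty → 0 < lowerDensity {t | T t x ∈ U}

/-- The Frequent Hypercyclicity Criterion, with `γ_n = γ (λ_n) (μ_n)` as the quantities that are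
required to be large and separated. In (i), "the supremum is `< ε`" is expressed by a uniform
bound `c < ε`. -/
def SatisfiesFHC {V : Type*} [NormedAddCommGroup V] (γ : ℂ → ℂ → V)
    (T : sector α hα → X →L[𝕂] X) : Prop :=
  IsC0Semigroup T ∧ TopologicalSpace.SeparableSpace X ∧
    ∃ (X₀ : Set X) (S : sector α hα → X₀ → X), Dense X₀ ∧ ∀ x : X₀,
      (∀ ε : ℝ, 0 < ε → ∃ r : ℝ, 0 < r ∧ ∃ c : ℝ, c < ε ∧
        ∀ (J : Finset ℕ) (l m : ℕ → sector α hα),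
          (∀ n ∈ J, r ≤ ‖γ (l n) (m n)‖) →
          (∀ n ∈ J, ∀ k ∈ J, n ≠ k → 1 ≤ ‖γ (l n) (m n) - γ (l k) (m k)‖) →
          ‖∑ n ∈ J, T (l n) (S (m n) x)‖ ≤ c) ∧
      Tendsto (fun t => T t (S t x))
        (comap (fun t : sector α hα => ‖(t : ℂ)‖) atTop) (𝓝 (x : X))

end Semigroups

/-! ### Weighted spaces and the translation semigroup -/

/-- Admissible weight functions `ρ : Δ → [0, ∞)`. -/
structure IsAdmissible (ρ : sector α hα → ℝ≥0) : Prop where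
  measurable : Measurable ρ
  growth : ∃ M w : ℝ, 1 ≤ M ∧ ∀ t t' : sector α hα,
    (ρ t : ℝ) ≤ M * Real.exp (w * ‖(t' : ℂ)‖) * ρ (t + t')

/-- The measure `ρ(τ) dτ` on the sector. -/
def weightMeasure (ρ : sector α hα → ℝ≥0) : Measure (sector α hα) :=
  (lebesgue : Measure (sector α hα)).withDensity fun s => (ρ s : ℝ≥0∞)

/-- The space `L^p_ρ(Δ, 𝕂)`. -/
abbrev LpWeighted (𝕂 : Type*) [RCLike 𝕂] (p : ℝ≥0∞) (ρ : sector α hα → ℝ≥0) : Type _ :=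
  Lp 𝕂 p (weightMeasure ρ)

theorem measurable_shift (t : sector α hα) : Measurable fun x : sector α hα => x + t :=
  ((measurable_subtype_coe.add_const (t : ℂ))).subtype_mk

theorem map_lebesgue_shift_le (t : sector α hα) :
    (lebesgue : Measure (sector α hα)).map (fun x => x + t) ≤ lebesgue := by
  refine Measure.le_iff.mpr fun A hA => ?_
  rw [Measure.map_apply (measurable_shift t) hA, lebesgue_apply, lebesgue_apply,
    ← measure_preimage_add_right volume (t : ℂ) (Subtype.val '' A)]
  refine measure_mono ?_
  rintro _ ⟨x, hx, rfl⟩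
  exact ⟨x + t, hx, rfl⟩

theorem exists_map_shift_le {ρ : sector α hα → ℝ≥0} (hρ : IsAdmissible ρ) (t : sector α hα) :
    ∃ C : ℝ≥0, C ≠ 0 ∧
      (weightMeasure ρ).map (fun x => x + t) ≤ (C : ℝ≥0∞) • weightMeasure ρ := by
  obtain ⟨M, w, hM, h⟩ := hρ.growth
  have hpos : 0 < M * Real.exp (w * ‖(t : ℂ)‖) := by positivity
  refine ⟨(M * Real.exp (w * ‖(t : ℂ)‖)).toNNReal, by simpa using hpos, ?_⟩
  set C : ℝ≥0 := (M * Real.exp (w * ‖(t : ℂ)‖)).toNNReal with hC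
  have hle : ∀ x, ρ x ≤ C * ρ (x + t) := fun x => by
    rw [← NNReal.coe_le_coe, NNReal.coe_mul, hC, Real.coe_toNNReal _ hpos.le]
    exact h x t
  refine Measure.le_iff.mpr fun A hA => ?_
  have hmρ : Measurable fun s => (ρ s : ℝ≥0∞) := hρ.measurable.coe_nnreal_ennreal
  have hmg : Measurable (A.indicator fun s => (C : ℝ≥0∞) * ρ s) :=
    (hmρ.const_mul _).indicator hA
  rw [Measure.map_apply (measurable_shift t) hA, Measure.smul_apply, weightMeasure,
    withDensity_apply _ (measurable_shift t hA), withDensity_apply _ hA, smul_eq_mul,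
    ← lintegral_const_mul _ hmρ, ← lintegral_indicator (measurable_shift t hA),
    ← lintegral_indicator hA]
  calc _ ≤ ∫⁻ x, (A.indicator fun s => (C : ℝ≥0∞) * ρ s) (x + t) ∂lebesgue := by
        refine lintegral_mono fun x => ?_
        by_cases hx : x + t ∈ A
        · rw [Set.indicator_of_mem (show x ∈ (fun x => x + t) ⁻¹' A from hx),
            Set.indicator_of_mem hx]
          simp only [← ENNReal.coe_mul]
          exact ENNReal.coe_le_coe.mpr (hle x)
        · rw [Set.indicator_of_notMem (show x ∉ (fun x => x + t) ⁻¹' A from hx)]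
          exact zero_le
    _ = ∫⁻ x, (A.indicator fun s => (C : ℝ≥0∞) * ρ s) x
          ∂((lebesgue : Measure (sector α hα)).map fun x => x + t) :=
        (lintegral_map hmg (measurable_shift t)).symm
    _ ≤ _ := lintegral_mono' (map_lebesgue_shift_le t) le_rfl

variable {𝕂 : Type*} [RCLike 𝕂] {p : ℝ≥0∞}

theorem quasiMeasurePreserving_shift {ρ : sector α hα → ℝ≥0} (hρ : IsAdmissible ρ)
    (t : sector α hα) : Measure.QuasiMeasurePreserving (fun x => x + t)
      (weightMeasure ρ) (weightMeasure ρ) := by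
  obtain ⟨C, -, h⟩ := exists_map_shift_le hρ t
  exact ⟨measurable_shift t, h.absolutelyContinuous.trans Measure.smul_absolutelyContinuous⟩

theorem memLp_shift {ρ : sector α hα → ℝ≥0} (hρ : IsAdmissible ρ) (t : sector α hα)
    (f : LpWeighted 𝕂 p ρ) : MemLp (fun x => f (x + t)) p (weightMeasure ρ) := by
  obtain ⟨C, -, h⟩ := exists_map_shift_le hρ t
  have h1 : MemLp f p ((weightMeasure ρ).map fun x => x + t) :=
    (Lp.memLp f).of_measure_le_smul ENNReal.coe_ne_top h
  exact h1.comp_of_map (measurable_shift t).aemeasurable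

/-- The function `x ↦ f (x + t)` as an element of `L^p_ρ(Δ, 𝕂)`. -/
def shiftLp {ρ : sector α hα → ℝ≥0} (hρ : IsAdmissible ρ)
    (t : sector α hα) (f : LpWeighted 𝕂 p ρ) : LpWeighted 𝕂 p ρ :=
  MemLp.toLp (fun x => f (x + t)) (memLp_shift hρ t f)

theorem coeFn_shiftLp {ρ : sector α hα → ℝ≥0} (hρ : IsAdmissible ρ)
    (t : sector α hα) (f : LpWeighted 𝕂 p ρ) :
    shiftLp hρ t f =ᵐ[weightMeasure ρ] fun x => f (x + t) :=
  MemLp.coeFn_toLp (memLp_shift hρ t f)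

theorem shiftLp_add {ρ : sector α hα → ℝ≥0} (hρ : IsAdmissible ρ) (t : sector α hα)
    (f g : LpWeighted 𝕂 p ρ) : shiftLp hρ t (f + g) = shiftLp hρ t f + shiftLp hρ t g := by
  refine Lp.ext ?_
  filter_upwards [coeFn_shiftLp hρ t (f + g), coeFn_shiftLp hρ t f, coeFn_shiftLp hρ t g,
    Lp.coeFn_add (shiftLp hρ t f) (shiftLp hρ t g),
    (quasiMeasurePreserving_shift hρ t).ae (Lp.coeFn_add f g)] with x h1 h2 h3 h4 h5
  rw [h1, h4, Pi.add_apply, h2, h3, h5, Pi.add_apply]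

theorem shiftLp_smul {ρ : sector α hα → ℝ≥0} (hρ : IsAdmissible ρ) (t : sector α hα)
    (c : 𝕂) (f : LpWeighted 𝕂 p ρ) : shiftLp hρ t (c • f) = c • shiftLp hρ t f := by
  refine Lp.ext ?_
  filter_upwards [coeFn_shiftLp hρ t (c • f), coeFn_shiftLp hρ t f,
    Lp.coeFn_smul c (shiftLp hρ t f),
    (quasiMeasurePreserving_shift hρ t).ae (Lp.coeFn_smul c f)] with x h1 h2 h3 h4
  rw [h1, h3, Pi.smul_apply, h2, h4, Pi.smul_apply]

theorem exists_norm_shiftLp_le [Fact (1 ≤ p)] {ρ : sector α hα → ℝ≥0} (hρ : IsAdmissible ρ)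
    (t : sector α hα) : ∃ K : ℝ, ∀ f : LpWeighted 𝕂 p ρ, ‖shiftLp hρ t f‖ ≤ K * ‖f‖ := by
  obtain ⟨C, -, h⟩ := exists_map_shift_le hρ t
  refine ⟨((C : ℝ≥0∞) ^ (1 / p).toReal).toReal, fun f => ?_⟩
  have hfin : (C : ℝ≥0∞) ^ (1 / p).toReal ≠ ⊤ :=
    ENNReal.rpow_ne_top_of_nonneg ENNReal.toReal_nonneg ENNReal.coe_ne_top
  have hm : AEStronglyMeasurable f ((weightMeasure ρ).map fun x => x + t) :=
    (Lp.aestronglyMeasurable f).mono_ac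
      (quasiMeasurePreserving_shift hρ t).absolutelyContinuous
  have hb : eLpNorm (shiftLp hρ t f) p (weightMeasure ρ) ≤
      (C : ℝ≥0∞) ^ (1 / p).toReal * eLpNorm f p (weightMeasure ρ) := by
    rw [eLpNorm_congr_ae (coeFn_shiftLp hρ t f)]
    refine (eLpNorm_map_measure hm (measurable_shift t).aemeasurable).symm.trans_le ?_
    simpa only [smul_eq_mul] using eLpNorm_le_of_measure_le_smul h
  rw [Lp.norm_def, Lp.norm_def, ← ENNReal.toReal_mul]
  exact ENNReal.toReal_mono (ENNReal.mul_ne_top hfin (Lp.eLpNorm_ne_top f)) hb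

/-- The translation semigroup `(T_t f)(x) = f (x + t)` on `L^p_ρ(Δ, 𝕂)`. -/
def translation (𝕂 : Type*) [RCLike 𝕂] (p : ℝ≥0∞) [Fact (1 ≤ p)] {ρ : sector α hα → ℝ≥0}
    (hρ : IsAdmissible ρ) (t : sector α hα) : LpWeighted 𝕂 p ρ →L[𝕂] LpWeighted 𝕂 p ρ :=
  LinearMap.mkContinuousOfExistsBound
    { toFun := shiftLp hρ t
      map_add' := shiftLp_add hρ t
      map_smul' := shiftLp_smul hρ t }
    (exists_norm_shiftLp_le hρ t)

/-- The operators `translation` act by the formula `(T_t f)(x) = f (x + t)`. -/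
theorem coeFn_translation [Fact (1 ≤ p)] {ρ : sector α hα → ℝ≥0} (hρ : IsAdmissible ρ)
    (t : sector α hα) (f : LpWeighted 𝕂 p ρ) :
    translation 𝕂 p hρ t f =ᵐ[weightMeasure ρ] fun x => f (x + t) :=
  coeFn_shiftLp hρ t f

end ComplexSector

end

noncomputable section

namespace ComplexSector

open scoped CompactlySupported

variable {α : ℝ} {hα : 0 < α ∧ α ≤ Real.pi / 2}
variable {𝕂 : Type*} [RCLike 𝕂] {p : ℝ≥0∞}

/-! ### The translation semigroup is strongly continuous -/

/-! Since `ρ dm` is finite, every continuous function with compact support in `ℂ` restricts to an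
element of `X`, and these restrictions are dense. Such an `F` is defined on the whole plane, so `F
(x + c)` makes sense for every complex `c`. Thus `S_μ` can be translation by `-μ`, and `T_λ S_μ F`
is `F (x + (λ - μ))`.

For the criterion, only boundedly many translates with 1-separated parameters can be nonzero at one
point, and if all parameters are large this happens only for large `|x|`. There the measure is small
(`exists_norm_sum_restrictLp_le`).

Frequent hypercyclicity is proved directly, not deduced from the criterion. The vector is a sum of
translates `F_k (x - μ)` with disjoint supports, where `μ` runs through a planar lattice in the
`k`-th of infinitely many disjoint subsectors (`exists_separated_families`). With large enough gaps,
the sum lies in `X`, and translating it by `μ` gives `F_k` up to an error that tends to zero with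
`k` (`exists_translation_approx`). Quadratic growth of the lattice, thickened by small translations,
gives positive lower density (`lowerDensity_pos_of_family`). -/

theorem map_shift_le_smul {ρ : sector α hα → ℝ≥0} (hρ : Measurable ρ) (t : sector α hα) {C : ℝ≥0}
    (hle : ∀ x, ρ x ≤ C * ρ (x + t)) :
    (weightMeasure ρ).map (fun x => x + t) ≤ (C : ℝ≥0∞) • weightMeasure ρ := by
  refine Measure.le_iff.mpr fun A hA => ?_
  have hmρ : Measurable fun s => (ρ s : ℝ≥0∞) := hρ.coe_nnreal_ennreal
  have hmg : Measurable (A.indicator fun s => (C : ℝ≥0∞) * ρ s) :=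
    (hmρ.const_mul _).indicator hA
  rw [Measure.map_apply (measurable_shift t) hA, Measure.smul_apply, weightMeasure,
    withDensity_apply _ (measurable_shift t hA), withDensity_apply _ hA, smul_eq_mul,
    ← lintegral_const_mul _ hmρ, ← lintegral_indicator (measurable_shift t hA),
    ← lintegral_indicator hA]
  calc _ ≤ ∫⁻ x, (A.indicator fun s => (C : ℝ≥0∞) * ρ s) (x + t) ∂lebesgue := by
        refine lintegral_mono fun x => ?_
        by_cases hx : x + t ∈ A
        · rw [Set.indicator_of_mem (show x ∈ (fun x => x + t) ⁻¹' A from hx),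
            Set.indicator_of_mem hx]
          simp only [← ENNReal.coe_mul]
          exact ENNReal.coe_le_coe.mpr (hle x)
        · rw [Set.indicator_of_notMem (show x ∉ (fun x => x + t) ⁻¹' A from hx)]
          exact zero_le
    _ = ∫⁻ x, (A.indicator fun s => (C : ℝ≥0∞) * ρ s) x
          ∂((lebesgue : Measure (sector α hα)).map fun x => x + t) :=
        (lintegral_map hmg (measurable_shift t)).symm
    _ ≤ _ := lintegral_mono' (map_lebesgue_shift_le t) le_rfl

/-- Replacing `w` by `|w|` makes the admissibility constant monotone in `|t'|`, hence uniform over a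
bounded set of times. Strong continuity needs this uniformity. -/
theorem exists_norm_translation_le_of_norm_le [Fact (1 ≤ p)] {ρ : sector α hα → ℝ≥0}
    (hρ : IsAdmissible ρ) (R : ℝ) :
    ∃ K : ℝ, 0 ≤ K ∧ ∀ t : sector α hα, ‖(t : ℂ)‖ ≤ R →
      ∀ f : LpWeighted 𝕂 p ρ, ‖translation 𝕂 p hρ t f‖ ≤ K * ‖f‖ := by
  obtain ⟨M, w, hM, h⟩ := hρ.growth
  set C : ℝ≥0 := (M * Real.exp (|w| * R)).toNNReal with hC
  refine ⟨((C : ℝ≥0∞) ^ (1 / p).toReal).toReal, ENNReal.toReal_nonneg, fun t ht f => ?_⟩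
  have hle : ∀ x, ρ x ≤ C * ρ (x + t) := fun x => by
    rw [← NNReal.coe_le_coe, NNReal.coe_mul, hC, Real.coe_toNNReal _ (by positivity)]
    refine (h x t).trans ?_
    have hw : w * ‖(t : ℂ)‖ ≤ |w| * R :=
      mul_le_mul (le_abs_self w) ht (norm_nonneg _) (abs_nonneg w)
    gcongr
  have hfin : (C : ℝ≥0∞) ^ (1 / p).toReal ≠ ⊤ :=
    ENNReal.rpow_ne_top_of_nonneg ENNReal.toReal_nonneg ENNReal.coe_ne_top
  have hm : AEStronglyMeasurable f ((weightMeasure ρ).map fun x => x + t) :=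
    (Lp.aestronglyMeasurable f).mono_ac
      (quasiMeasurePreserving_shift hρ t).absolutelyContinuous
  have hb : eLpNorm (translation 𝕂 p hρ t f) p (weightMeasure ρ) ≤
      (C : ℝ≥0∞) ^ (1 / p).toReal * eLpNorm f p (weightMeasure ρ) := by
    rw [eLpNorm_congr_ae (coeFn_translation hρ t f)]
    refine (eLpNorm_map_measure hm (measurable_shift t).aemeasurable).symm.trans_le ?_
    simpa only [smul_eq_mul] using
      eLpNorm_le_of_measure_le_smul (map_shift_le_smul hρ.measurable t hle)
  rw [Lp.norm_def, Lp.norm_def, ← ENNReal.toReal_mul]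
  exact ENNReal.toReal_mono (ENNReal.mul_ne_top hfin (Lp.eLpNorm_ne_top f)) hb

theorem translation_zero [Fact (1 ≤ p)] {ρ : sector α hα → ℝ≥0} (hρ : IsAdmissible ρ) :
    translation 𝕂 p hρ 0 = ContinuousLinearMap.id 𝕂 (LpWeighted 𝕂 p ρ) := by
  ext1 f
  refine Lp.ext ?_
  filter_upwards [coeFn_translation hρ 0 f] with x hx
  simpa using hx

theorem translation_add [Fact (1 ≤ p)] {ρ : sector α hα → ℝ≥0} (hρ : IsAdmissible ρ)
    (s t : sector α hα) :
    translation 𝕂 p hρ (s + t) = (translation 𝕂 p hρ s).comp (translation 𝕂 p hρ t) := by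
  ext1 f
  refine Lp.ext ?_
  filter_upwards [coeFn_translation hρ (s + t) f, coeFn_translation hρ s (translation 𝕂 p hρ t f),
    (quasiMeasurePreserving_shift hρ s).ae (coeFn_translation hρ t f)] with x h1 h2 h3
  rw [ContinuousLinearMap.comp_apply, h1, h2, h3, add_assoc]

/-! ### Restrictions of compactly supported functions -/

theorem isFiniteMeasure_weightMeasure {ρ : sector α hα → ℝ≥0}
    (hint : ∫⁻ s, (ρ s : ℝ≥0∞) ∂lebesgue < ∞) : IsFiniteMeasure (weightMeasure ρ) :=
  ⟨by rwa [weightMeasure, withDensity_apply _ MeasurableSet.univ, Measure.restrict_univ]⟩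

theorem exists_bound_and_radius (F : C_c(ℂ, 𝕂)) :
    ∃ B R : ℝ, 0 ≤ B ∧ (∀ z, ‖F z‖ ≤ B) ∧ ∀ z, F z ≠ 0 → ‖z‖ ≤ R := by
  obtain ⟨B, hB⟩ := F.hasCompactSupport.exists_bound_of_continuous F.continuous
  obtain ⟨R, hR⟩ := F.hasCompactSupport.isCompact.isBounded.exists_norm_le
  exact ⟨B, R, (norm_nonneg _).trans (hB 0), hB, fun z hz => hR z (subset_tsupport _ hz)⟩

section Restrict

variable {ρ : sector α hα → ℝ≥0} [IsFiniteMeasure (weightMeasure ρ)]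

theorem memLp_restrict (p : ℝ≥0∞) (ρ : sector α hα → ℝ≥0) [IsFiniteMeasure (weightMeasure ρ)]
    (F : C_c(ℂ, 𝕂)) (c : ℂ) :
    MemLp (fun x : sector α hα => F (x + c)) p (weightMeasure ρ) := by
  obtain ⟨B, R, -, hB, -⟩ := exists_bound_and_radius F
  refine MemLp.of_bound ?_ B (Eventually.of_forall fun x => hB _)
  exact ((F.continuous.measurable).comp
    (measurable_subtype_coe.add_const c)).aestronglyMeasurable

/-- The class of `x ↦ F (x + c)` in `L^p_ρ(Δ, 𝕂)`, for `F` continuous with compact support in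
`ℂ`. -/
def restrictLp (p : ℝ≥0∞) (ρ : sector α hα → ℝ≥0) [IsFiniteMeasure (weightMeasure ρ)]
    (F : C_c(ℂ, 𝕂)) (c : ℂ) : LpWeighted 𝕂 p ρ :=
  (memLp_restrict p ρ F c).toLp _

theorem coeFn_restrictLp (F : C_c(ℂ, 𝕂)) (c : ℂ) :
    restrictLp p ρ F c =ᵐ[weightMeasure ρ] fun x => F (x + c) :=
  MemLp.coeFn_toLp (memLp_restrict p ρ F c)

theorem translation_restrictLp [Fact (1 ≤ p)] (hρ : IsAdmissible ρ) (t : sector α hα)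
    (F : C_c(ℂ, 𝕂)) (c : ℂ) :
    translation 𝕂 p hρ t (restrictLp p ρ F c) = restrictLp p ρ F (t + c) := by
  refine Lp.ext ?_
  filter_upwards [coeFn_translation hρ t (restrictLp p ρ F c), coeFn_restrictLp (p := p) F (t + c),
    (quasiMeasurePreserving_shift hρ t).ae (coeFn_restrictLp (p := p) (ρ := ρ) F c)] with x h1 h2 h3
  rw [h1, h2, h3, AddSubmonoid.coe_add, add_assoc]

/-- `F` is uniformly continuous, and on a finite measure space uniform closeness controls the `L^p`
norm. -/
theorem continuous_restrictLp [Fact (1 ≤ p)] (F : C_c(ℂ, 𝕂)) :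
    Continuous (restrictLp p ρ F) := by
  have hu : UniformContinuous F :=
    F.continuous.uniformContinuous_of_tendsto_cocompact
      (x := 0) F.hasCompactSupport.is_zero_at_infty
  refine Metric.continuous_iff.2 fun c ε hε => ?_
  set A : ℝ := measureUnivNNReal (weightMeasure ρ) ^ p.toReal⁻¹ with hA
  have hA0 : 0 ≤ A := by positivity
  obtain ⟨δ, hδ, h⟩ := Metric.uniformContinuous_iff.1 hu (ε / (A + 1)) (by positivity)
  refine ⟨δ, hδ, fun c' hc' => ?_⟩
  rw [dist_eq_norm]
  have hle : ‖restrictLp p ρ F c' - restrictLp p ρ F c‖ ≤ A * (ε / (A + 1)) := by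
    refine Lp.norm_le_of_ae_bound (by positivity) ?_
    filter_upwards [Lp.coeFn_sub (restrictLp p ρ F c') (restrictLp p ρ F c),
      coeFn_restrictLp (p := p) (ρ := ρ) F c', coeFn_restrictLp (p := p) (ρ := ρ) F c]
      with x h1 h2 h3
    rw [h1, Pi.sub_apply, h2, h3, ← dist_eq_norm]
    exact (h (by simpa using hc')).le
  refine hle.trans_lt ?_
  rw [← mul_div_assoc, div_lt_iff₀ (by positivity)]
  nlinarith

theorem dense_range_restrictLp [Fact (1 ≤ p)] (hp : p ≠ ∞) :
    Dense (Set.range fun F : C_c(ℂ, 𝕂) => restrictLp p ρ F 0) := by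
  refine Metric.dense_iff.2 fun f ε hε => ?_
  have hemb : MeasurableEmbedding (Subtype.val : sector α hα → ℂ) :=
    MeasurableEmbedding.subtype_coe (measurableSet_sector hα)
  -- The value 0 off the sector is immaterial: the pushforward measure gives no mass there. Density
  -- of `C_c` is then applied in the plane.
  set g : ℂ → 𝕂 := Function.extend Subtype.val f 0 with hg
  have hgf : g ∘ (Subtype.val : sector α hα → ℂ) = f :=
    Function.extend_comp Subtype.val_injective f 0
  have hmem : MemLp g p ((weightMeasure ρ).map Subtype.val) := by
    rw [hemb.memLp_map_measure_iff, hgf]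
    exact Lp.memLp f
  have : IsFiniteMeasure ((weightMeasure ρ).map Subtype.val) := inferInstance
  obtain ⟨G, hG, hle, hGc, -⟩ := hmem.exists_hasCompactSupport_eLpNorm_sub_le hp
    (ε := ENNReal.ofReal (ε / 2)) (by simpa using hε)
  let F : C_c(ℂ, 𝕂) := ⟨⟨G, hGc⟩, hG⟩
  refine ⟨restrictLp p ρ F 0, ?_, F, rfl⟩
  rw [hemb.eLpNorm_map_measure] at hle
  have hnorm : ‖f - restrictLp p ρ F 0‖ ≤ ε / 2 := by
    rw [Lp.norm_def]
    refine ENNReal.toReal_le_of_le_ofReal (by positivity) (le_trans (le_of_eq ?_) hle)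
    refine eLpNorm_congr_ae ?_
    filter_upwards [Lp.coeFn_sub f (restrictLp p ρ F 0), coeFn_restrictLp (p := p) (ρ := ρ) F 0]
      with x h1 h2
    rw [h1, Pi.sub_apply, h2, ← hgf, add_zero]
    rfl
  rw [Metric.mem_ball, dist_comm, dist_eq_norm]
  linarith

/-- Near a given time, the orbit is a uniform limit of the continuous orbits of restricted `C_c`
functions, by density and the local uniform bound on the operators. -/
theorem continuous_translation_apply [Fact (1 ≤ p)] (hp : p ≠ ∞) (hρ : IsAdmissible ρ)
    (f : LpWeighted 𝕂 p ρ) : Continuous fun t => translation 𝕂 p hρ t f := by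
  refine continuous_of_locally_uniform_approx_of_continuousAt fun t U hU => ?_
  obtain ⟨ε, hε, hεU⟩ := Metric.mem_uniformity_dist.1 hU
  obtain ⟨K, hK0, hK⟩ := exists_norm_translation_le_of_norm_le (𝕂 := 𝕂) (p := p) hρ (‖(t : ℂ)‖ + 1)
  obtain ⟨_, hg, F, rfl⟩ := Metric.dense_iff.1 (dense_range_restrictLp (𝕂 := 𝕂) (ρ := ρ) hp) f
    (ε / (K + 1)) (by positivity)
  refine ⟨{s | ‖(s : ℂ)‖ < ‖(t : ℂ)‖ + 1}, ?_, fun s => translation 𝕂 p hρ s (restrictLp p ρ F 0),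
    ?_, fun s hs => hεU ?_⟩
  · exact (isOpen_lt (by fun_prop) (by fun_prop)).mem_nhds
      (show ‖(t : ℂ)‖ < ‖(t : ℂ)‖ + 1 from lt_add_one _)
  · simp only [translation_restrictLp]
    exact ((continuous_restrictLp F).comp (by fun_prop)).continuousAt
  · rw [dist_eq_norm, ← map_sub]
    have hs' : ‖(s : ℂ)‖ < ‖(t : ℂ)‖ + 1 := hs
    have h1 := hK s hs'.le (f - restrictLp p ρ F 0)
    rw [Metric.mem_ball, dist_comm, dist_eq_norm, lt_div_iff₀ (by positivity)] at hg
    have := norm_nonneg (f - restrictLp p ρ F 0)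
    nlinarith

theorem isC0Semigroup_translation [Fact (1 ≤ p)] (hp : p ≠ ∞) (hρ : IsAdmissible ρ) :
    IsC0Semigroup (translation 𝕂 p hρ) :=
  ⟨translation_zero hρ, translation_add hρ, continuous_translation_apply hp hρ⟩

theorem separableSpace_lpWeighted [Fact (1 ≤ p)] (hp : p ≠ ∞) :
    TopologicalSpace.SeparableSpace (LpWeighted 𝕂 p ρ) := by
  have : Fact (p ≠ ∞) := ⟨hp⟩
  infer_instance

end Restrict

/-! ### The Frequent Hypercyclicity Criterion -/

/-- A bounded subset of the plane contains boundedly many points at mutual distance at least `1`. -/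
theorem exists_card_le_of_separated (R : ℝ) :
    ∃ N : ℕ, ∀ (J : Finset ℕ) (z : ℕ → ℂ), (∀ n ∈ J, ‖z n‖ ≤ R) →
      (∀ n ∈ J, ∀ k ∈ J, n ≠ k → 1 ≤ ‖z n - z k‖) → J.card ≤ N := by
  set I : Finset ℤ := Finset.Icc ⌊-(2 * R)⌋ ⌊2 * R⌋ with hI
  refine ⟨(I ×ˢ I).card, fun J z hz hsep => ?_⟩
  -- Cells of side 1/2: two points in one cell have `|re| + |im|` of their difference below 1,
  -- contradicting separation.
  refine Finset.card_le_card_of_injOn (fun n => (⌊2 * (z n).re⌋, ⌊2 * (z n).im⌋)) ?_ ?_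
  · intro n hn
    have hn := hz n hn
    have h1 := abs_le.1 ((Complex.abs_re_le_norm (z n)).trans hn)
    have h2 := abs_le.1 ((Complex.abs_im_le_norm (z n)).trans hn)
    simp only [hI, Finset.coe_product, Set.mem_prod, Finset.mem_coe, Finset.mem_Icc]
    exact ⟨⟨Int.floor_le_floor (by linarith), Int.floor_le_floor (by linarith)⟩,
      ⟨Int.floor_le_floor (by linarith), Int.floor_le_floor (by linarith)⟩⟩
  · intro n hn k hk heq
    by_contra hne
    have h1 := Int.abs_sub_lt_one_of_floor_eq_floor (congrArg Prod.fst heq)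
    have h2 := Int.abs_sub_lt_one_of_floor_eq_floor (congrArg Prod.snd heq)
    rw [← mul_sub, abs_mul, abs_two] at h1 h2
    have h3 := Complex.norm_le_abs_re_add_abs_im (z n - z k)
    rw [Complex.sub_re, Complex.sub_im] at h3
    linarith [hsep n hn k hk hne]

section Criterion

variable {ρ : sector α hα → ℝ≥0} [IsFiniteMeasure (weightMeasure ρ)]

/-- This decay of tails is the source of smallness both in the criterion and in the construction of
the frequently hypercyclic vector. -/
theorem tendsto_weightMeasure_norm_ge :
    Tendsto (fun r : ℝ => weightMeasure ρ {x | r ≤ ‖(x : ℂ)‖}) atTop (𝓝 0) := by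
  have hmeas : ∀ r : ℝ, MeasurableSet {x : sector α hα | r ≤ ‖(x : ℂ)‖} := fun r =>
    measurableSet_le measurable_const measurable_subtype_coe.norm
  have h := tendsto_measure_iInter_atTop (μ := weightMeasure ρ)
    (s := fun r : ℝ => {x : sector α hα | r ≤ ‖(x : ℂ)‖})
    (fun r => (hmeas r).nullMeasurableSet)
    (fun a b hab x hx => le_trans hab hx) ⟨0, measure_ne_top _ _⟩
  have hempty : ⋂ r : ℝ, {x : sector α hα | r ≤ ‖(x : ℂ)‖} = ∅ := by
    ext x
    simp only [Set.mem_iInter, Set.mem_ofPred_eq, Set.mem_empty_iff_false, iff_false, not_forall,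
      not_le]
    exact ⟨‖(x : ℂ)‖ + 1, lt_add_one _⟩
  rwa [hempty, measure_empty] at h

theorem coeFn_sum_restrictLp (F : C_c(ℂ, 𝕂)) (J : Finset ℕ) (c : ℕ → ℂ) :
    ⇑(∑ n ∈ J, restrictLp p ρ F (c n)) =ᵐ[weightMeasure ρ] fun x => ∑ n ∈ J, F (x + c n) := by
  classical
  induction J using Finset.induction_on with
  | empty =>
    filter_upwards [Lp.coeFn_zero 𝕂 p (weightMeasure ρ)] with x hx
    simpa using hx
  | insert n J hn ih =>
    rw [Finset.sum_insert hn]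
    filter_upwards [Lp.coeFn_add (restrictLp p ρ F (c n)) (∑ n ∈ J, restrictLp p ρ F (c n)), ih,
      coeFn_restrictLp (p := p) (ρ := ρ) F (c n)] with x h1 h2 h3
    rw [h1, Pi.add_apply, h2, h3, Finset.sum_insert hn]

theorem exists_norm_sum_restrictLp_le [Fact (1 ≤ p)] (hp : p ≠ ∞) (F : C_c(ℂ, 𝕂)) {ε : ℝ}
    (hε : 0 < ε) :
    ∃ r : ℝ, 0 < r ∧ ∀ (J : Finset ℕ) (c : ℕ → ℂ), (∀ n ∈ J, r ≤ ‖c n‖) →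
      (∀ n ∈ J, ∀ k ∈ J, n ≠ k → 1 ≤ ‖c n - c k‖) →
        ‖∑ n ∈ J, restrictLp p ρ F (c n)‖ ≤ ε := by
  obtain ⟨B, R, hB0, hB, hR⟩ := exists_bound_and_radius F
  obtain ⟨N, hN⟩ := exists_card_le_of_separated R
  have hp1 : (1 : ℝ≥0∞) ≤ p := Fact.out
  have hp0 : p ≠ 0 := (zero_lt_one.trans_le hp1).ne'
  have hpr : 0 < p.toReal := ENNReal.toReal_pos hp0 hp
  have htend : Tendsto (fun r : ℝ => ‖N * B‖ₑ *
      weightMeasure ρ {x | r ≤ ‖(x : ℂ)‖} ^ (1 / p.toReal)) atTop (𝓝 0) := by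
    have h1 := (ENNReal.continuous_rpow_const (y := 1 / p.toReal)).tendsto 0
    rw [ENNReal.zero_rpow_of_pos (by positivity)] at h1
    have h2 := ENNReal.Tendsto.const_mul (a := ‖N * B‖ₑ)
      (h1.comp (tendsto_weightMeasure_norm_ge (ρ := ρ))) (Or.inr enorm_ne_top)
    rwa [mul_zero] at h2
  obtain ⟨r₀, hr₀⟩ := (htend.eventually (gt_mem_nhds (ENNReal.ofReal_pos.2 hε))).exists
  -- A term nonzero at `x` has `|x + c n| ≤ R`, so `|c n| ≥ r₀ + R` forces `|x| ≥ r₀`. The sum is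
  -- then at most `N * B` there and vanishes elsewhere. The 1 only ensures positivity.
  refine ⟨max (r₀ + R) 1, by positivity, fun J c hc hsep => ?_⟩
  rw [Lp.norm_def]
  refine ENNReal.toReal_le_of_le_ofReal hε.le (le_trans ?_ hr₀.le)
  rw [← eLpNorm_indicator_const (measurableSet_le measurable_const measurable_subtype_coe.norm)
    hp0 hp, eLpNorm_congr_ae (coeFn_sum_restrictLp F J c)]
  refine eLpNorm_mono fun x => ?_
  classical
  have hsum : ∑ n ∈ J, F (x + c n) = ∑ n ∈ J with F (x + c n) ≠ 0, F (x + c n) :=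
    (Finset.sum_filter_ne_zero J).symm
  have hmem : ∀ n ∈ J.filter fun n => F (x + c n) ≠ 0, n ∈ J ∧ ‖(x : ℂ) + c n‖ ≤ R := fun n hn =>
    ⟨(Finset.mem_filter.1 hn).1, hR _ (Finset.mem_filter.1 hn).2⟩
  by_cases hx : r₀ ≤ ‖(x : ℂ)‖
  · rw [Set.indicator_of_mem (show x ∈ {x : sector α hα | r₀ ≤ ‖(x : ℂ)‖} from hx), hsum,
      Real.norm_of_nonneg (by positivity)]
    refine (norm_sum_le_of_le _ fun n _ => hB _).trans ?_
    rw [Finset.sum_const, nsmul_eq_mul]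
    gcongr
    refine hN _ (fun n => x + c n) (fun n hn => (hmem n hn).2) fun n hn k hk hne => ?_
    rw [add_sub_add_left_eq_sub]
    exact hsep n (hmem n hn).1 k (hmem k hk).1 hne
  · rw [hsum, Finset.sum_eq_zero, norm_zero]
    · exact norm_nonneg _
    · intro n hn
      exfalso
      have h1 := (le_max_left _ _).trans (hc n (hmem n hn).1)
      have h2 := norm_sub_le ((x : ℂ) + c n) x
      rw [add_sub_cancel_left] at h2
      linarith [(hmem n hn).2]

/-- Both choices of `γ` are 1-Lipschitz functions of `l - m`, so largeness and separation of `γ`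
pass to the complex differences, where the estimate is available. -/
theorem satisfiesFHC_translation [Fact (1 ≤ p)] (hp : p ≠ ∞) (hρ : IsAdmissible ρ)
    {V : Type*} [NormedAddCommGroup V] (γ : ℂ → ℂ → V) (hγ : ∀ l m, ‖γ l m‖ ≤ ‖l - m‖)
    (hγ' : ∀ l m l' m', ‖γ l m - γ l' m'‖ ≤ ‖(l - m) - (l' - m')‖) :
    SatisfiesFHC γ (translation 𝕂 p hρ) := by
  refine ⟨isC0Semigroup_translation hp hρ, separableSpace_lpWeighted hp,
    Set.range fun F : C_c(ℂ, 𝕂) => restrictLp p ρ F 0,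
    fun t x => restrictLp p ρ x.2.choose (-t), dense_range_restrictLp hp, fun x => ⟨?_, ?_⟩⟩
  · intro ε hε
    obtain ⟨r, hr, h⟩ := exists_norm_sum_restrictLp_le (ρ := ρ) hp x.2.choose (half_pos hε)
    refine ⟨r, hr, ε / 2, half_lt_self hε, fun J l m hJ hsep => ?_⟩
    simp only [translation_restrictLp, ← sub_eq_add_neg]
    exact h J (fun n => l n - m n) (fun n hn => (hJ n hn).trans (hγ _ _))
      fun n hn k hk hne => (hsep n hn k hk hne).trans (hγ' _ _ _ _)
  · simp only [translation_restrictLp, add_neg_cancel]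
    exact tendsto_const_nhds.congr fun _ => x.2.choose_spec.symm

end Criterion

/-! ### Separated lattices in disjoint subsectors -/

/-- Using slope `sin α` instead of `tan α` gives up part of the sector but treats `α = π/2`
uniformly. -/
theorem add_mul_I_mem_sector (hα : 0 < α ∧ α ≤ Real.pi / 2) {x y : ℝ} (hx : 0 ≤ x)
    (hy : |y| ≤ x * Real.sin α) : (⟨x, y⟩ : ℂ) ∈ sector α hα := by
  refine (mem_sectorSet_iff hα _).2 ⟨hx, (mul_le_of_le_one_right (abs_nonneg y) ?_).trans hy⟩
  exact Real.cos_le_one α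

/-- The slope of the `k`-th boundary ray of the subsectors. -/
def raySlope (α : ℝ) (k : ℕ) : ℝ := Real.sin α / (k + 1)

/-- The points `L ((a + 1) d_k + (b + 1) d_{k+1})`, where `d_k = 1 + i s_k` spans the ray with
slope `s_k = raySlope α k`. -/
def conePoint (α : ℝ) (L : ℝ) (k a b : ℕ) : ℂ :=
  ⟨L * ((a + 1) + (b + 1)), L * ((a + 1) * raySlope α k + (b + 1) * raySlope α (k + 1))⟩

theorem sin_pos_of_sector_angle (hα : 0 < α ∧ α ≤ Real.pi / 2) : 0 < Real.sin α :=
  Real.sin_pos_of_pos_of_lt_pi hα.1 (by linarith [Real.pi_pos, hα.2])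

theorem raySlope_pos (hα : 0 < α ∧ α ≤ Real.pi / 2) (k : ℕ) : 0 < raySlope α k :=
  div_pos (sin_pos_of_sector_angle hα) (by positivity)

theorem strictAnti_raySlope (hα : 0 < α ∧ α ≤ Real.pi / 2) : StrictAnti (raySlope α) := by
  refine strictAnti_nat_of_succ_lt fun k => ?_
  have := sin_pos_of_sector_angle hα
  simp only [raySlope, Nat.cast_add, Nat.cast_one]
  gcongr
  linarith

theorem raySlope_le_sin (hα : 0 < α ∧ α ≤ Real.pi / 2) (k : ℕ) : raySlope α k ≤ Real.sin α :=
  div_le_self (sin_pos_of_sector_angle hα).le (by linarith [Nat.cast_nonneg (α := ℝ) k])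

theorem conePoint_mem_sector (hα : 0 < α ∧ α ≤ Real.pi / 2) {L : ℝ} (hL : 0 ≤ L) (k a b : ℕ) :
    conePoint α L k a b ∈ sector α hα := by
  have h1 := raySlope_pos hα k
  have h2 := raySlope_pos hα (k + 1)
  refine add_mul_I_mem_sector hα (by positivity) ?_
  rw [abs_of_nonneg (by positivity), mul_assoc]
  have h3 := raySlope_le_sin hα k
  have h4 := raySlope_le_sin hα (k + 1)
  calc _ ≤ L * ((a + 1) * Real.sin α + (b + 1) * Real.sin α) := by gcongr
    _ = _ := by ring

theorem norm_conePoint_le (hα : 0 < α ∧ α ≤ Real.pi / 2) {L : ℝ} (hL : 0 ≤ L) (k : ℕ)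
    {a b n : ℕ} (ha : a < n) (hb : b < n) : ‖conePoint α L k a b‖ ≤ 4 * L * n := by
  have h1 := raySlope_pos hα k
  have h2 := raySlope_pos hα (k + 1)
  have h1' := (raySlope_le_sin hα k).trans (Real.sin_le_one α)
  have h2' := (raySlope_le_sin hα (k + 1)).trans (Real.sin_le_one α)
  have ha' : (a : ℝ) + 1 ≤ n := by exact_mod_cast ha
  have hb' : (b : ℝ) + 1 ≤ n := by exact_mod_cast hb
  refine (Complex.norm_le_abs_re_add_abs_im _).trans ?_
  simp only [conePoint]
  rw [abs_of_nonneg (by positivity), abs_of_nonneg (by positivity)]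
  calc _ ≤ L * (n + n) + L * (n * 1 + n * 1) := by gcongr
    _ = 4 * L * n := by ring

theorem abs_im_sub_mul_re_le (z : ℂ) {s : ℝ} (h0 : 0 ≤ s) (h1 : s ≤ 1) :
    |z.im - s * z.re| ≤ 2 * ‖z‖ := by
  have h2 := Complex.abs_re_le_norm z
  have h3 := Complex.abs_im_le_norm z
  have h4 : |s * z.re| ≤ 1 * ‖z‖ := by
    rw [abs_mul, abs_of_nonneg h0]
    gcongr
  linarith [abs_sub z.im (s * z.re)]

/-- The functional `im z - s_{k+1} re z` separates the cones: it is at least `2 N k` on the `k`-th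
family and at most `-2 N l` on the `l`-th, while it is bounded by `2 ‖z‖`. The offsets `+ 1` in
`conePoint` keep the points away from the shared boundary rays. -/
theorem le_norm_conePoint_sub_of_lt (hα : 0 < α ∧ α ≤ Real.pi / 2) {N L : ℕ → ℝ}
    (hL0 : ∀ k, 0 ≤ L k)
    (hL : ∀ k, 2 * N k ≤ L k * (raySlope α k - raySlope α (k + 1))) {k l : ℕ} (hkl : k < l)
    (a b c d : ℕ) : N k + N l ≤ ‖conePoint α (L k) k a b - conePoint α (L l) l c d‖ := by
  have hanti := strictAnti_raySlope hα
  have h1 := (abs_le.1 (abs_im_sub_mul_re_le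
    (conePoint α (L k) k a b - conePoint α (L l) l c d) (raySlope_pos hα (k + 1)).le
    ((raySlope_le_sin hα (k + 1)).trans (Real.sin_le_one α)))).2
  simp only [conePoint, Complex.sub_re, Complex.sub_im] at h1 ⊢
  have hk : 0 ≤ raySlope α k - raySlope α (k + 1) := sub_nonneg.2 (hanti k.lt_succ_self).le
  have hl : 0 ≤ raySlope α l - raySlope α (l + 1) := sub_nonneg.2 (hanti l.lt_succ_self).le
  have hkl' : 0 ≤ raySlope α (k + 1) - raySlope α l := sub_nonneg.2 (hanti.antitone hkl)
  have e1 : 0 ≤ L k * a * (raySlope α k - raySlope α (k + 1)) :=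
    mul_nonneg (mul_nonneg (hL0 k) a.cast_nonneg) hk
  have e2 : 0 ≤ L l * (c + d + 2) * (raySlope α (k + 1) - raySlope α l) :=
    mul_nonneg (mul_nonneg (hL0 l) (by positivity)) hkl'
  have e3 : 0 ≤ L l * d * (raySlope α l - raySlope α (l + 1)) :=
    mul_nonneg (mul_nonneg (hL0 l) d.cast_nonneg) hl
  linarith [hL k, hL l]

/-- The same functional kills the direction of `b`, so it detects a change in `a`; if `a` is
unchanged, the real part detects the change in `b`. -/
theorem le_norm_conePoint_sub_of_ne (hα : 0 < α ∧ α ≤ Real.pi / 2) {N L : ℝ} {k : ℕ}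
    (hL0 : 0 ≤ L) (hL : 4 * N ≤ L * (raySlope α k - raySlope α (k + 1))) {a b c d : ℕ}
    (hne : (a, b) ≠ (c, d)) : N + N ≤ ‖conePoint α L k a b - conePoint α L k c d‖ := by
  have hanti := strictAnti_raySlope hα
  have hgap : 0 ≤ raySlope α k - raySlope α (k + 1) := sub_nonneg.2 (hanti k.lt_succ_self).le
  have hgap1 : raySlope α k - raySlope α (k + 1) ≤ 1 := by
    linarith [raySlope_pos hα (k + 1), (raySlope_le_sin hα k).trans (Real.sin_le_one α)]
  have key : ∀ m n : ℕ, m ≠ n → (1 : ℝ) ≤ |(m : ℝ) - n| := fun m n hmn => by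
    have : (1 : ℤ) ≤ |(m : ℤ) - n| := Int.one_le_abs (sub_ne_zero.2 (by exact_mod_cast hmn))
    exact_mod_cast this
  rcases eq_or_ne a c with rfl | hac
  · have hbd : b ≠ d := fun h => hne (by rw [h])
    have h1 := Complex.abs_re_le_norm (conePoint α L k a b - conePoint α L k a d)
    have e : (conePoint α L k a b - conePoint α L k a d).re = L * (b - d) := by
      simp only [conePoint, Complex.sub_re]
      ring
    rw [e, abs_mul, abs_of_nonneg hL0] at h1
    have h2 := mul_le_mul_of_nonneg_left (key b d hbd) hL0
    have h3 := mul_le_mul_of_nonneg_left hgap1 hL0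
    have h4 := mul_nonneg hL0 hgap
    linarith
  · have h1 := abs_im_sub_mul_re_le
      (conePoint α L k a b - conePoint α L k c d) (raySlope_pos hα (k + 1)).le
      ((raySlope_le_sin hα (k + 1)).trans (Real.sin_le_one α))
    have e : (conePoint α L k a b - conePoint α L k c d).im -
        raySlope α (k + 1) * (conePoint α L k a b - conePoint α L k c d).re =
        L * (raySlope α k - raySlope α (k + 1)) * (a - c) := by
      simp only [conePoint, Complex.sub_re, Complex.sub_im]
      ring
    rw [e, abs_mul, abs_of_nonneg (mul_nonneg hL0 hgap)] at h1
    have h2 := mul_le_mul_of_nonneg_left (key a c hac) (mul_nonneg hL0 hgap)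
    linarith

/-- There are families `(μ k a b)_{a, b}` of points of the sector, each with quadratic growth, such
that points of the `k`-th and of the `l`-th family are at distance at least `N k + N l`. -/
theorem exists_separated_families (hα : 0 < α ∧ α ≤ Real.pi / 2) (N : ℕ → ℝ) (hN : ∀ k, 0 < N k) :
    ∃ (μ : ℕ × ℕ × ℕ → sector α hα) (L : ℕ → ℝ), (∀ k, 0 < L k) ∧
      (∀ k n a b, a < n → b < n → ‖(μ (k, a, b) : ℂ)‖ ≤ L k * n) ∧
      (∀ i, N i.1 ≤ ‖(μ i : ℂ)‖) ∧
      ∀ i j, i ≠ j → N i.1 + N j.1 ≤ ‖(μ i : ℂ) - μ j‖ := by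
  have hgap : ∀ k, 0 < raySlope α k - raySlope α (k + 1) := fun k =>
    sub_pos.2 (strictAnti_raySlope hα k.lt_succ_self)
  -- The factor 4 is what separation within one cone requires; distinct cones need only 2.
  set L : ℕ → ℝ := fun k => 4 * N k / (raySlope α k - raySlope α (k + 1)) with hLdef
  have hL0 : ∀ k, 0 < L k := fun k => div_pos (by linarith [hN k]) (hgap k)
  have hL : ∀ k, L k * (raySlope α k - raySlope α (k + 1)) = 4 * N k := fun k =>
    div_mul_cancel₀ _ (hgap k).ne'
  refine ⟨fun i => ⟨conePoint α (L i.1) i.1 i.2.1 i.2.2, conePoint_mem_sector hα (hL0 _).le _ _ _⟩,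
    fun k => 4 * L k, fun k => by linarith [hL0 k], fun k n a b ha hb =>
      norm_conePoint_le hα (hL0 k).le k ha hb, ?_, ?_⟩
  · rintro ⟨k, a, b⟩
    have h1 := (le_abs_self _).trans (Complex.abs_re_le_norm (conePoint α (L k) k a b))
    refine le_trans ?_ h1
    simp only [conePoint]
    have hgap1 : raySlope α k - raySlope α (k + 1) ≤ 1 := by
      linarith [raySlope_pos hα (k + 1), (raySlope_le_sin hα k).trans (Real.sin_le_one α)]
    have h2 := mul_le_mul_of_nonneg_left hgap1 (hL0 k).le
    have h3 := mul_nonneg (hL0 k).le (a.cast_nonneg (α := ℝ))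
    have h4 := mul_nonneg (hL0 k).le (b.cast_nonneg (α := ℝ))
    linarith [hL k, hN k]
  · rintro ⟨k, a, b⟩ ⟨l, c, d⟩ hne
    have hL' : ∀ k, 2 * N k ≤ L k * (raySlope α k - raySlope α (k + 1)) := fun k => by
      rw [hL]
      linarith [hN k]
    rcases lt_trichotomy k l with hkl | rfl | hkl
    · exact le_norm_conePoint_sub_of_lt hα (fun k => (hL0 k).le) hL' hkl a b c d
    · exact le_norm_conePoint_sub_of_ne hα (hL0 k).le (hL k).ge fun h => hne (by rw [h])
    · rw [add_comm, norm_sub_rev]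
      exact le_norm_conePoint_sub_of_lt hα (fun k => (hL0 k).le) hL' hkl c d a b

/-! ### Positive lower density from lattices of times -/

theorem volume_sector_inter_ball_pos (hα : 0 < α ∧ α ≤ Real.pi / 2) {δ : ℝ} (hδ : 0 < δ) :
    0 < volume ((sector α hα : Set ℂ) ∩ Metric.ball 0 δ) := by
  have hs := sin_pos_of_sector_angle hα
  have hopen : IsOpen ({z : ℂ | |z.im| < z.re * Real.sin α} ∩ Metric.ball 0 δ) :=
    (isOpen_lt (by fun_prop) (by fun_prop)).inter Metric.isOpen_ball
  refine (hopen.measure_pos volume ⟨((δ / 2 : ℝ) : ℂ), ?_, ?_⟩).trans_le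
    (measure_mono (Set.inter_subset_inter_left _ fun z hz => ?_))
  · change |((δ / 2 : ℝ) : ℂ).im| < ((δ / 2 : ℝ) : ℂ).re * Real.sin α
    rw [Complex.ofReal_im, Complex.ofReal_re, abs_zero]
    positivity
  · rw [mem_ball_zero_iff, Complex.norm_of_nonneg (by positivity)]
    exact half_lt_self hδ
  · have hz' : |z.im| < z.re * Real.sin α := hz
    have hre : 0 < z.re := pos_of_mul_pos_left ((abs_nonneg _).trans_lt hz') hs.le
    exact add_mul_I_mem_sector hα hre.le hz'.le

/-- The pieces `μ i + D`, with `D` the part of the sector in a small ball, are disjoint and lie in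
`A`. About `(r / L)²` of them fit within radius `r`, against a total area at most `π r²`. -/
theorem lowerDensity_pos_of_family {A : Set (sector α hα)} {μ : ℕ × ℕ → sector α hα} {L δ : ℝ}
    (hL : 0 < L) (hδ : 0 < δ) (hδ1 : δ ≤ 1)
    (hnorm : ∀ n a b, a < n → b < n → ‖(μ (a, b) : ℂ)‖ ≤ L * n)
    (hsep : ∀ i j, i ≠ j → 2 ≤ ‖(μ i : ℂ) - μ j‖)
    (hA : ∀ i (s : sector α hα), ‖(s : ℂ)‖ < δ → s + μ i ∈ A) : 0 < lowerDensity A := by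
  set D : Set ℂ := (sector α hα : Set ℂ) ∩ Metric.ball 0 δ with hD
  have hDm : MeasurableSet D := (measurableSet_sector hα).inter measurableSet_ball
  have hlow : ∀ (r : ℝ) (n : ℕ), L * n + 1 ≤ r →
      (n : ℝ≥0∞) ^ 2 * volume D ≤ lebesgue (A ∩ {s : sector α hα | ‖(s : ℂ)‖ ≤ r}) := by
    intro r n hn
    set I : Finset (ℕ × ℕ) := Finset.range n ×ˢ Finset.range n with hI
    have hdisj : Set.PairwiseDisjoint (I : Set (ℕ × ℕ)) fun i => (fun z => z - (μ i : ℂ)) ⁻¹' D := by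
      intro i _ j _ hij
      refine Set.disjoint_left.2 fun z hzi hzj => ?_
      have h1 := mem_ball_zero_iff.1 hzi.2
      have h2 := mem_ball_zero_iff.1 hzj.2
      have h3 := norm_sub_le (z - (μ j : ℂ)) (z - μ i)
      rw [sub_sub_sub_cancel_left] at h3
      linarith [hsep i j hij]
    have hvol : volume (⋃ i ∈ I, (fun z => z - (μ i : ℂ)) ⁻¹' D) = (n : ℝ≥0∞) ^ 2 * volume D := by
      have hpre : ∀ c : ℂ, volume ((fun z => z - c) ⁻¹' D) = volume D := fun c => by
        simpa only [sub_eq_add_neg] using measure_preimage_add_right volume (-c) D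
      rw [measure_biUnion_finset hdisj fun i _ => (measurable_id.sub_const _) hDm]
      simp only [hpre, Finset.sum_const, hI, Finset.card_product,
        Finset.card_range, nsmul_eq_mul, Nat.cast_mul, sq]
    rw [← hvol, lebesgue_apply]
    refine measure_mono (Set.iUnion₂_subset fun i hi z hz => ?_)
    obtain ⟨hz1, hz2⟩ := hz
    have hz2 := mem_ball_zero_iff.1 hz2
    have hi := Finset.mem_product.1 hi
    refine ⟨⟨z - μ i, hz1⟩ + μ i, ⟨hA i _ hz2, ?_⟩, sub_add_cancel z _⟩
    have h1 := norm_add_le (z - μ i) (μ i)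
    have h2 := hnorm n i.1 i.2 (Finset.mem_range.1 hi.1) (Finset.mem_range.1 hi.2)
    change ‖z - μ i + (μ i : ℂ)‖ ≤ r
    linarith
  have hupp : ∀ r : ℝ, lebesgue {s : sector α hα | ‖(s : ℂ)‖ ≤ r} ≤
      ENNReal.ofReal r ^ 2 * NNReal.pi := by
    intro r
    rw [lebesgue_apply, ← Complex.volume_closedBall 0 r]
    refine measure_mono ?_
    rintro _ ⟨s, hs, rfl⟩
    exact mem_closedBall_zero_iff.2 hs
  have hpi0 : (NNReal.pi : ℝ≥0∞) ≠ 0 := by simpa using NNReal.pi_ne_zero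
  set c : ℝ≥0∞ := ENNReal.ofReal (1 / (2 * L)) ^ 2 * volume D / NNReal.pi with hc
  have hc0 : 0 < c := by
    refine ENNReal.div_pos (mul_ne_zero (pow_ne_zero 2 ?_) ?_) ENNReal.coe_ne_top
    · exact (ENNReal.ofReal_pos.2 (by positivity)).ne'
    · exact (volume_sector_inter_ball_pos hα hδ).ne'
  refine hc0.trans_le (le_liminf_of_le (by isBoundedDefault) ?_)
  filter_upwards [eventually_ge_atTop (2 * (L + 1)), eventually_gt_atTop 0] with r hr hr0
  -- The 1 leaves room for the radius `δ ≤ 1` of the pieces; `r ≥ 2 (L + 1)` then gives `n ≥ r / (2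
  -- L)`, the source of the constant `c`.
  set n : ℕ := ⌊(r - 1) / L⌋₊ with hn
  have hn1 : L * n + 1 ≤ r := by
    have := Nat.floor_le (a := (r - 1) / L) (div_nonneg (by linarith) hL.le)
    rw [le_div_iff₀ hL] at this
    linarith
  have hn2 : r * (1 / (2 * L)) ≤ n := by
    have := Nat.lt_floor_add_one ((r - 1) / L)
    rw [div_lt_iff₀ hL] at this
    rw [mul_one_div, div_le_iff₀ (by positivity)]
    linarith
  rw [ENNReal.le_div_iff_mul_le]
  · calc c * lebesgue {s : sector α hα | ‖(s : ℂ)‖ ≤ r}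
        ≤ c * (ENNReal.ofReal r ^ 2 * NNReal.pi) := by gcongr; exact hupp r
      _ = (ENNReal.ofReal r * ENNReal.ofReal (1 / (2 * L))) ^ 2 * volume D *
            (NNReal.pi / NNReal.pi) := by
          rw [hc]
          generalize ENNReal.ofReal (1 / (2 * L)) = e
          simp only [div_eq_mul_inv]
          ring
      _ = ENNReal.ofReal (r * (1 / (2 * L))) ^ 2 * volume D := by
          rw [ENNReal.div_self hpi0 ENNReal.coe_ne_top, mul_one, ENNReal.ofReal_mul hr0.le]
      _ ≤ (n : ℝ≥0∞) ^ 2 * volume D := by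
          gcongr
          rw [← ENNReal.ofReal_natCast]
          exact ENNReal.ofReal_le_ofReal hn2
      _ ≤ _ := hlow r n hn1
  · refine Or.inl (ne_of_gt ((volume_sector_inter_ball_pos hα hr0).trans_le ?_))
    rw [lebesgue_apply]
    exact measure_mono fun z hz => ⟨⟨z, hz.1⟩, (mem_ball_zero_iff.1 hz.2).le, rfl⟩
  · exact Or.inl (ne_top_of_le_ne_top (ENNReal.mul_ne_top (by finiteness) ENNReal.coe_ne_top)
      (hupp r))

/-! ### Superposition of translates with disjoint supports -/

section Superposition

variable {ι : Type*} {G : ι → ℂ → 𝕂}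

theorem tsum_eq_of_disjoint_support (hG : ∀ z i j, i ≠ j → G i z ≠ 0 → G j z = 0) {z : ℂ} {i : ι}
    (hi : G i z ≠ 0) : ∑' j, G j z = G i z :=
  tsum_eq_single i fun j hj => hG z i j hj.symm hi

theorem exists_tsum_eq_of_ne_zero (hG : ∀ z i j, i ≠ j → G i z ≠ 0 → G j z = 0) {z : ℂ}
    (hz : ∑' j, G j z ≠ 0) : ∃ i, G i z ≠ 0 ∧ ∑' j, G j z = G i z := by
  obtain ⟨i, hi⟩ : ∃ i, G i z ≠ 0 := by
    by_contra! h
    exact hz (by simp [h])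
  exact ⟨i, hi, tsum_eq_of_disjoint_support hG hi⟩

/-- At each point at most one term is nonzero, so the finite partial sums converge pointwise. -/
theorem measurable_tsum_of_disjoint_support [Countable ι] (hm : ∀ i, Measurable (G i))
    (hG : ∀ z i j, i ≠ j → G i z ≠ 0 → G j z = 0) : Measurable fun z => ∑' i, G i z := by
  refine measurable_of_tendsto_metrizable' (atTop : Filter (Finset ι))
    (f := fun s z => ∑ i ∈ s, G i z) (fun s => Finset.measurable_fun_sum s fun i _ => hm i)
    (tendsto_pi_nhds.2 fun z => ?_)
  have hfin : (Function.support fun i => G i z).Finite :=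
    Set.Subsingleton.finite fun i hi j hj => by
      by_contra hij
      exact hj (hG z i j hij hi)
  have hsum : Summable fun i => G i z := summable_of_hasFiniteSupport hfin
  exact hsum.hasSum

end Superposition

/-! ### Construction of a frequently hypercyclic vector -/

section Orbit

variable {ρ : sector α hα → ℝ≥0} [IsFiniteMeasure (weightMeasure ρ)]

/-- Thresholds at which constants may be added up with finite integral. -/
theorem exists_lintegral_tsum_indicator_lt_top (B : ℕ → ℝ≥0∞) (hB : ∀ k, B k ≠ ∞) :
    ∃ D : ℕ → ℝ, (∀ k, 0 ≤ D k) ∧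
      ∫⁻ x, ∑' k, {x : sector α hα | D k ≤ ‖(x : ℂ)‖}.indicator (fun _ => B k) x
        ∂(weightMeasure ρ) ≠ ∞ := by
  have hmeas : ∀ r : ℝ, MeasurableSet {x : sector α hα | r ≤ ‖(x : ℂ)‖} := fun r =>
    measurableSet_le measurable_const measurable_subtype_coe.norm
  -- The bounds `2⁻¹ ^ k` are summable, with total 2.
  have key : ∀ k, ∃ D : ℝ, 0 ≤ D ∧
      B k * weightMeasure ρ {x | D ≤ ‖(x : ℂ)‖} ≤ 2⁻¹ ^ k := by
    intro k
    have h := ENNReal.Tendsto.const_mul (a := B k) (tendsto_weightMeasure_norm_ge (ρ := ρ))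
      (Or.inr (hB k))
    rw [mul_zero] at h
    have hpos : (0 : ℝ≥0∞) < 2⁻¹ ^ k := ENNReal.pow_pos (by simp) k
    obtain ⟨D, hD, hD0⟩ := ((h.eventually (gt_mem_nhds hpos)).and (eventually_ge_atTop 0)).exists
    exact ⟨D, hD0, hD.le⟩
  choose D hD0 hD using key
  refine ⟨D, hD0, ?_⟩
  rw [lintegral_tsum fun k => (measurable_const.indicator (hmeas _)).aemeasurable]
  simp only [lintegral_indicator_const (hmeas _)]
  refine ne_top_of_le_ne_top ?_ (ENNReal.tsum_le_tsum hD)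
  rw [ENNReal.tsum_geometric, ENNReal.one_sub_inv_two, inv_inv]
  exact ENNReal.ofNat_ne_top

theorem eLpNorm_le_of_rpow_enorm_le {X : Type*} [MeasurableSpace X] {ν : Measure X}
    (hp0 : p ≠ 0) (hp : p ≠ ∞) {f : X → 𝕂} {W : X → ℝ≥0∞}
    (h : ∀ x, ‖f x‖ₑ ^ p.toReal ≤ W x) :
    eLpNorm f p ν ≤ (∫⁻ x, W x ∂ν) ^ (1 / p.toReal) := by
  rw [eLpNorm_eq_lintegral_rpow_enorm_toReal hp0 hp]
  exact ENNReal.rpow_le_rpow (lintegral_mono h) (by positivity)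

/-- For every sequence of compactly supported continuous functions there is one vector whose
translates along separated families of times approximate the members of the sequence. -/
theorem exists_translation_approx [Fact (1 ≤ p)] (hp : p ≠ ∞) (hρ : IsAdmissible ρ)
    (F : ℕ → C_c(ℂ, 𝕂)) :
    ∃ (u : LpWeighted 𝕂 p ρ) (μ : ℕ × ℕ × ℕ → sector α hα) (L : ℕ → ℝ) (e : ℕ → ℝ),
      (∀ k, 0 < L k) ∧ (∀ k n a b, a < n → b < n → ‖(μ (k, a, b) : ℂ)‖ ≤ L k * n) ∧
      (∀ i j, i ≠ j → 2 ≤ ‖(μ i : ℂ) - μ j‖) ∧ Tendsto e atTop (𝓝 0) ∧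
      ∀ i, ‖translation 𝕂 p hρ (μ i) u - restrictLp p ρ (F i.1) 0‖ ≤ e i.1 := by
  have hp0 : p ≠ 0 := (zero_lt_one.trans_le (Fact.out : (1 : ℝ≥0∞) ≤ p)).ne'
  have hpr : 0 < p.toReal := ENNReal.toReal_pos hp0 hp
  choose B R hB0 hB hR using fun k => exists_bound_and_radius (F k)
  obtain ⟨D, hD0, hD⟩ := exists_lintegral_tsum_indicator_lt_top (ρ := ρ)
    (fun k => ENNReal.ofReal (B k) ^ p.toReal) fun k => by finiteness
  set W : sector α hα → ℝ≥0∞ := fun x => ∑' k, {x : sector α hα | D k ≤ ‖(x : ℂ)‖}.indicator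
    (fun _ => ENNReal.ofReal (B k) ^ p.toReal) x with hW
  -- `|R k|` absorbs the support of `F k`, `D k` places its translates where `W` dominates, and `k`
  -- sends the error to zero.
  set N : ℕ → ℝ := fun k => D k + |R k| + k + 1 with hN
  have hN1 : ∀ k, 1 ≤ N k := fun k => by
    have := hD0 k
    have := abs_nonneg (R k)
    have := k.cast_nonneg (α := ℝ)
    simp only [hN]
    linarith
  have hNk : ∀ k : ℕ, (k : ℝ) ≤ N k := fun k => by
    have := hD0 k
    have := abs_nonneg (R k)
    simp only [hN]
    linarith
  have hNR : ∀ k, D k + R k < N k := fun k => by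
    have := le_abs_self (R k)
    have := k.cast_nonneg (α := ℝ)
    simp only [hN]
    linarith
  obtain ⟨μ, L, hL, hμL, hμN, hsep⟩ := exists_separated_families hα N fun k => by linarith [hN1 k]
  set G : ℕ × ℕ × ℕ → ℂ → 𝕂 := fun i z => F i.1 (z - μ i) with hGdef
  have hG : ∀ z i j, i ≠ j → G i z ≠ 0 → G j z = 0 := by
    intro z i j hij hi
    by_contra hj
    have h1 := hR i.1 _ hi
    have h2 := hR j.1 _ hj
    have h3 := norm_sub_le (z - (μ j : ℂ)) (z - μ i)
    rw [sub_sub_sub_cancel_left] at h3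
    linarith [hsep i j hij, hNR i.1, hNR j.1, hD0 i.1, hD0 j.1]
  set Φ : ℂ → 𝕂 := fun z => ∑' i, G i z with hΦ
  have hΦm : Measurable Φ := measurable_tsum_of_disjoint_support
    (fun i => (F i.1).continuous.measurable.comp (measurable_id.sub_const _)) hG
  have hWle : ∀ (k : ℕ) (z : ℂ) (x : sector α hα), D k ≤ ‖(x : ℂ)‖ →
      ‖F k z‖ₑ ^ p.toReal ≤ W x := by
    intro k z x hx
    refine le_trans ?_ (ENNReal.le_tsum k)
    rw [Set.indicator_of_mem (show x ∈ {x : sector α hα | D k ≤ ‖(x : ℂ)‖} from hx)]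
    refine ENNReal.rpow_le_rpow ?_ hpr.le
    rw [← ofReal_norm]
    exact ENNReal.ofReal_le_ofReal (hB k z)
  have hΦW : ∀ x : sector α hα, ‖Φ x‖ₑ ^ p.toReal ≤ W x := by
    intro x
    by_cases hx : Φ x = 0
    · simp [hx, hpr]
    obtain ⟨j, hj, hj'⟩ := exists_tsum_eq_of_ne_zero hG hx
    change ‖∑' i, G i x‖ₑ ^ p.toReal ≤ W x
    rw [hj']
    refine hWle _ _ x ?_
    have h1 := hR j.1 _ hj
    have h2 := norm_sub_le (x : ℂ) (x - μ j)
    rw [sub_sub_cancel] at h2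
    linarith [hμN j, hNR j.1]
  have hΦmem : MemLp (fun x : sector α hα => Φ x) p (weightMeasure ρ) :=
    ⟨(hΦm.comp measurable_subtype_coe).aestronglyMeasurable,
      (eLpNorm_le_of_rpow_enorm_le hp0 hp hΦW).trans_lt
        (ENNReal.rpow_lt_top_of_nonneg (by positivity) hD)⟩
  -- Where the difference is nonzero, only a term `j ≠ i` contributes, so `|x| ≥ N i.1 + N j.1 - R
  -- j.1`. This exceeds `N i.1` and `D j.1`, so `W` dominates.
  have hdiff : ∀ i (x : sector α hα), ‖Φ (x + μ i) - F i.1 x‖ₑ ^ p.toReal ≤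
      {x : sector α hα | N i.1 ≤ ‖(x : ℂ)‖}.indicator W x := by
    intro i x
    by_cases hx : Φ (x + μ i) - F i.1 x = 0
    · simp [hx, hpr]
    have hGi : G i (x + μ i) = F i.1 x := by simp only [hGdef, add_sub_cancel_right]
    have hFx : F i.1 x = 0 := by
      by_contra hne
      rw [← hGi] at hne hx
      exact hx (sub_eq_zero.2 (tsum_eq_of_disjoint_support hG hne))
    rw [hFx, sub_zero] at hx ⊢
    obtain ⟨j, hj, hj'⟩ := exists_tsum_eq_of_ne_zero hG hx
    have hij : i ≠ j := by
      rintro rfl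
      exact hj (hGi.trans hFx)
    have h1 := hR j.1 _ hj
    have h2 := norm_sub_le ((x : ℂ) + μ i - μ j) x
    rw [add_sub_assoc, add_sub_cancel_left] at h2
    rw [add_sub_assoc] at h1
    have h3 := hsep i j hij
    rw [Set.indicator_of_mem (show x ∈ {x : sector α hα | N i.1 ≤ ‖(x : ℂ)‖} from by
      change N i.1 ≤ ‖(x : ℂ)‖
      linarith [hNR j.1, hD0 j.1])]
    change ‖∑' l, G l (x + μ i)‖ₑ ^ p.toReal ≤ W x
    rw [hj']
    exact hWle _ _ x (by linarith [hNR j.1, hN1 i.1])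
  have hmeas : ∀ r : ℝ, MeasurableSet {x : sector α hα | r ≤ ‖(x : ℂ)‖} := fun r =>
    measurableSet_le measurable_const measurable_subtype_coe.norm
  have hfin : ∀ k, ∫⁻ x in {x : sector α hα | N k ≤ ‖(x : ℂ)‖}, W x ∂(weightMeasure ρ) ≠ ∞ :=
    fun k => ne_top_of_le_ne_top hD (setLIntegral_le_lintegral _ _)
  refine ⟨hΦmem.toLp _, μ, L, fun k => ((∫⁻ x in {x : sector α hα | N k ≤ ‖(x : ℂ)‖}, W x
    ∂(weightMeasure ρ)) ^ (1 / p.toReal)).toReal, hL, hμL, fun i j hij => ?_, ?_, fun i => ?_⟩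
  · linarith [hsep i j hij, hN1 i.1, hN1 j.1]
  · have h1 : Tendsto N atTop atTop := tendsto_atTop_mono hNk tendsto_natCast_atTop_atTop
    -- Absolute continuity of the integral of `W` on the shrinking tails.
    have h2 := tendsto_setLIntegral_zero hD ((tendsto_weightMeasure_norm_ge (ρ := ρ)).comp h1)
    have h3 := ((ENNReal.continuous_rpow_const (y := 1 / p.toReal)).tendsto 0).comp h2
    rw [ENNReal.zero_rpow_of_pos (by positivity)] at h3
    rw [← ENNReal.toReal_zero]
    exact (ENNReal.tendsto_toReal ENNReal.zero_ne_top).comp h3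
  · rw [Lp.norm_def]
    refine ENNReal.toReal_mono (ENNReal.rpow_ne_top_of_nonneg (by positivity) (hfin _)) ?_
    rw [← lintegral_indicator (hmeas _)]
    refine le_trans (le_of_eq (eLpNorm_congr_ae ?_)) (eLpNorm_le_of_rpow_enorm_le hp0 hp (hdiff i))
    filter_upwards [Lp.coeFn_sub (translation 𝕂 p hρ (μ i) (hΦmem.toLp _))
      (restrictLp p ρ (F i.1) 0), coeFn_translation hρ (μ i) (hΦmem.toLp _),
      coeFn_restrictLp (p := p) (ρ := ρ) (F i.1) 0,
      (quasiMeasurePreserving_shift hρ (μ i)).ae hΦmem.coeFn_toLp] with x h1 h2 h3 h4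
    rw [h1, Pi.sub_apply, h2, h3, h4, add_zero, AddSubmonoid.coe_add]

/-- Strong continuity at 0 and the uniform bound for `|s| ≤ 1` allow each discrete hitting time to
be thickened to a set of positive area. -/
theorem exists_forall_translation_mem [Fact (1 ≤ p)] (hp : p ≠ ∞) (hρ : IsAdmissible ρ)
    {U : Set (LpWeighted 𝕂 p ρ)} (hU : IsOpen U) {f : LpWeighted 𝕂 p ρ} (hf : f ∈ U) :
    ∃ δ η : ℝ, 0 < δ ∧ δ ≤ 1 ∧ 0 < η ∧ ∀ (s : sector α hα) (g : LpWeighted 𝕂 p ρ),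
      ‖(s : ℂ)‖ < δ → ‖g - f‖ ≤ η → translation 𝕂 p hρ s g ∈ U := by
  obtain ⟨ε, hε, hεU⟩ := Metric.isOpen_iff.1 hU f hf
  obtain ⟨K, hK0, hK⟩ := exists_norm_translation_le_of_norm_le (𝕂 := 𝕂) (p := p) hρ 1
  have hcont := (continuous_translation_apply hp hρ f).continuousAt (x := 0)
  obtain ⟨δ, hδ, h⟩ := Metric.continuousAt_iff.1 hcont (ε / 2) (half_pos hε)
  refine ⟨min δ 1, ε / 2 / (K + 1), by positivity, min_le_right _ _, by positivity,
    fun s g hs hg => hεU ?_⟩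
  have h1 : dist (translation 𝕂 p hρ s f) f < ε / 2 := by
    have h1 := h (x := s) (by
      rw [Subtype.dist_eq, ZeroMemClass.coe_zero, dist_zero_right]
      exact hs.trans_le (min_le_left _ _))
    simpa only [translation_zero, ContinuousLinearMap.id_apply] using h1
  have h2 : dist (translation 𝕂 p hρ s g) (translation 𝕂 p hρ s f) ≤ ε / 2 := by
    rw [dist_eq_norm, ← map_sub]
    have h3 := hK s (hs.le.trans (min_le_right _ _)) (g - f)
    rw [le_div_iff₀ (by positivity)] at hg
    nlinarith [norm_nonneg (g - f)]
  rw [Metric.mem_ball]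
  exact (dist_triangle _ _ _).trans_lt (by linarith)

theorem isFrequentlyHypercyclic_translation [Fact (1 ≤ p)] (hp : p ≠ ∞) (hρ : IsAdmissible ρ) :
    IsFrequentlyHypercyclic (translation 𝕂 p hρ) := by
  have : TopologicalSpace.SeparableSpace (LpWeighted 𝕂 p ρ) := separableSpace_lpWeighted hp
  set X₀ : Set (LpWeighted 𝕂 p ρ) := Set.range fun F : C_c(ℂ, 𝕂) => restrictLp p ρ F 0
  have : Nonempty X₀ := ⟨⟨_, 0, rfl⟩⟩
  have : SecondCountableTopology (LpWeighted 𝕂 p ρ) :=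
    UniformSpace.secondCountable_of_separable _
  have hdense : DenseRange fun k => (TopologicalSpace.denseSeq X₀ k : LpWeighted 𝕂 p ρ) :=
    (dense_range_restrictLp hp).denseRange_val.comp (TopologicalSpace.denseRange_denseSeq X₀)
      continuous_subtype_val
  choose F hF using fun k => (TopologicalSpace.denseSeq X₀ k).2
  obtain ⟨u, μ, L, e, hL, hμL, hsep, he, hu⟩ :=
    -- Unpairing lists every `F m` infinitely often, so each is approximated with arbitrarily small
    -- error.
    exists_translation_approx hp hρ fun k => F k.unpair.1
  refine ⟨u, fun U hU hUne => ?_⟩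
  obtain ⟨m, hm⟩ := hdense.exists_mem_open hU hUne
  rw [← hF m] at hm
  obtain ⟨δ, η, hδ, hδ1, hη, hδη⟩ := exists_forall_translation_mem hp hρ hU hm
  obtain ⟨n₀, hn₀⟩ := eventually_atTop.1 (he.eventually (gt_mem_nhds hη))
  -- The second coordinate serves only to make `k ≥ n₀`, so that `e k < η`.
  set k : ℕ := Nat.pair m n₀ with hk
  refine lowerDensity_pos_of_family (μ := fun i => μ (k, i)) (hL k) hδ hδ1
    (fun n a b => hμL k n a b) (fun i j hij => hsep _ _ fun h => hij (Prod.ext_iff.1 h).2) ?_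
  intro i s hs
  change translation 𝕂 p hρ (s + μ (k, i)) u ∈ U
  rw [translation_add]
  refine hδη s _ hs ?_
  have h1 := hu (k, i)
  simp only [hk, Nat.unpair_pair] at h1
  exact h1.trans (hn₀ _ (Nat.right_le_pair m n₀)).le

end Orbit

end ComplexSector

end

open ComplexSector in
theorem theorem3p1 {𝕂 : Type*} [RCLike 𝕂] (α : ℝ) (hα : 0 < α ∧ α ≤ Real.pi / 2)
    (p : ℝ≥0∞) [Fact (1 ≤ p)] (hp : p ≠ ∞)
    (ρ : sector α hα → ℝ≥0) (hρ : IsAdmissible ρ) (hint : ∫⁻ s, (ρ s : ℝ≥0∞) ∂lebesgue < ∞) :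
    SatisfiesFHC (fun l m : ℂ => ‖l - m‖) (translation 𝕂 p hρ) ∧
      SatisfiesFHC (fun l m : ℂ => l - m) (translation 𝕂 p hρ) ∧
      IsFrequentlyHypercyclic (translation 𝕂 p hρ) := by
  have := isFiniteMeasure_weightMeasure hint
  exact ⟨satisfiesFHC_translation hp hρ _ (fun l m => (norm_norm _).le)
      fun l m l' m' => abs_norm_sub_norm_le _ _,
    satisfiesFHC_translation hp hρ _ (fun l m => le_rfl) fun l m l' m' => le_rfl,
    isFrequentlyHypercyclic_translation hp hρ⟩
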